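/- Let $d\ge 1$ be an integer, $L>0$, let $\mathcal R=L\mathbb Z^d$ with dual lattice $\mathcal R^*=\frac{2\pi}{L}\mathbb Z^d$, and write $e_k(x)=L^{-d/2}e^{ik\cdot x}$ for $k\in\mathcal R^*$. An $\mathcal R$-periodic distribution $V$ has Fourier coefficients $\widehat V_k=V(e_{-k})$, so that $V=\sum_{k\in\mathcal R^*}\widehat V_k e_k$. For $t\in\mathbb R$ the operator $(-\Delta+1)^t$ is the Fourier multiplier $(1+|k|^2)^t$, and for $s\in\mathbb R$ the space $H^s_{\rm per}$ consists of the real $\mathcal R$-periodic distributions $V$ with $$\|V\|_{H^s_{\rm per}}=\Big(\sum_{k\in\mathcal R^*}(1+|k|^2)^s|\widehat V_k|^2\Big)^{1/2}<\infty .$$ For $r\in\mathbb R$ let $$\|V\|_r=\big\|(-\Delta+1)^{-1/2+r/2}\,V\,(-\Delta+1)^{-1/2+r/2}\big\|\in[0,\infty]$$ be the operator norm on the $\mathcal R$-periodic $L^2$ functions, where $V$ acts by multiplication. (The operator is defined on the dense subspace of trigonometric polynomials, and the norm is $\infty$ if it has no bounded extension.) We say that $V$ satisfies the assumption for $r$ if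 $V$ is real, $\mathcal R$-periodic and $\|V\|_r<\infty$. Let $s\in\mathbb R$ and $0\le r\le 1$ satisfy $$r\le s+1\qquad\text{and}\qquad r<1+\frac s2-\frac d4 .$$ Then every $V\in H^s_{\rm per}$ satisfies the assumption for $r$. Moreover, there is a constant $C_{r,s}$, depending only on $r$, $s$, $d$ and $L$, such that for all $V\in H^s_{\rm per}$ $$\|V\|_r\le C_{r,s}\,\|V\|_{H^s_{\rm per}} .$$ -/

import Mathlib

open scoped ENNReal NNReal

noncomputable section

namespace PeriodicPotential

/-- The lattice vector `L m` of the cubic lattice `L ℤ^d`. -/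
def latticeVec {d : ℕ} (L : ℝ) (m : Fin d → ℤ) : EuclideanSpace ℝ (Fin d) :=
  WithLp.toLp 2 (fun i => L * (m i : ℝ))

/-- The vector `k = (2π/L) n` of the dual lattice; the dual lattice is indexed by `n ∈ ℤ^d`. -/
def dualVec {d : ℕ} (L : ℝ) (n : Fin d → ℤ) : EuclideanSpace ℝ (Fin d) :=
  WithLp.toLp 2 (fun i => 2 * Real.pi / L * (n i : ℝ))

/-- The `*`-algebra of periodic test functions: smooth complex-valued functions on `ℝ^d` that are
periodic with respect to `L ℤ^d`, with pointwise operations and complex conjugation. -/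
def TestFn (d : ℕ) (L : ℝ) : StarSubalgebra ℂ (EuclideanSpace ℝ (Fin d) → ℂ) where
  carrier := {φ | ContDiff ℝ (⊤ : ℕ∞) φ ∧
    ∀ (m : Fin d → ℤ) (x : EuclideanSpace ℝ (Fin d)), φ (x + latticeVec L m) = φ x}
  mul_mem' := by
    rintro φ ψ ⟨hφ, hφ'⟩ ⟨hψ, hψ'⟩
    exact ⟨hφ.mul hψ, fun m x => by simp only [Pi.mul_apply, hφ', hψ']⟩
  add_mem' := by
    rintro φ ψ ⟨hφ, hφ'⟩ ⟨hψ, hψ'⟩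
    exact ⟨hφ.add hψ, fun m x => by simp only [Pi.add_apply, hφ', hψ']⟩
  algebraMap_mem' := fun c => ⟨contDiff_const, fun _ _ => rfl⟩
  star_mem' := by
    rintro φ ⟨hφ, hφ'⟩
    exact ⟨Complex.conjCLE.contDiff.comp hφ, fun m x => by simp only [Pi.star_apply, hφ']⟩

/-- Periodic distributions: linear functionals on the periodic test functions that are continuous
for the `C^∞` topology, i.e. bounded by a multiple of some `C^N` norm. -/
structure PeriodicDistribution (d : ℕ) (L : ℝ) where
  /-- the pairing with test functions -/
  toLin : TestFn d L →ₗ[ℂ] ℂ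
  continuous' : ∃ (N : ℕ) (C : ℝ), ∀ (φ : TestFn d L) (B : ℝ),
    (∀ j ≤ N, ∀ x, ‖iteratedFDeriv ℝ j (φ : EuclideanSpace ℝ (Fin d) → ℂ) x‖ ≤ B) →
      ‖toLin φ‖ ≤ C * B

/-- A distribution is real if `V(φ̄)` is the conjugate of `V(φ)` for all test functions `φ`. -/
def PeriodicDistribution.IsReal {d : ℕ} {L : ℝ} (V : PeriodicDistribution d L) : Prop :=
  ∀ φ : TestFn d L, V.toLin (star φ) = star (V.toLin φ)

/-- The normalized plane wave `e_k(x) = L^{-d/2} exp(i k·x)`, `k = (2π/L) n`. -/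
def planeWave {d : ℕ} (L : ℝ) (n : Fin d → ℤ) : TestFn d L :=
  ⟨fun x => ((L ^ (-(d : ℝ) / 2) : ℝ) : ℂ) *
      Complex.exp (Complex.I * ((inner ℝ (dualVec L n) x : ℝ) : ℂ)), by
    constructor
    · have h : ContDiff ℝ (⊤ : ℕ∞) (fun x : EuclideanSpace ℝ (Fin d) =>
          ((inner ℝ (dualVec L n) x : ℝ) : ℂ)) :=
        Complex.ofRealCLM.contDiff.comp (contDiff_const.inner ℝ contDiff_id)
      exact contDiff_const.mul ((contDiff_const.mul h).cexp)
    · intro m x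
      have h : ∃ N : ℤ, (inner ℝ (dualVec L n) (latticeVec L m) : ℝ) = N * (2 * Real.pi) := by
        by_cases hL : L = 0
        · exact ⟨0, by simp [latticeVec, hL, PiLp.inner_apply]⟩
        · refine ⟨∑ i, n i * m i, ?_⟩
          simp only [dualVec, latticeVec, PiLp.inner_apply, Int.cast_sum, Finset.sum_mul]
          refine Finset.sum_congr rfl fun i _ => ?_
          simp only [RCLike.inner_apply, conj_trivial, Int.cast_mul]
          field_simp
      obtain ⟨N, hN⟩ := h
      simp only [inner_add_right, hN]
      congr 1
      rw [Complex.exp_eq_exp_iff_exists_int]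
      exact ⟨N, by push_cast; ring⟩⟩

/-- The Fourier coefficient `T̂_k = ⟨e_k, T⟩ = T(e_{-k})` (as `e_{-k}` is the conjugate of `e_k`),
so that `T = ∑ T̂_k e_k`. -/
def coeff {d : ℕ} {L : ℝ} (T : TestFn d L →ₗ[ℂ] ℂ) (n : Fin d → ℤ) : ℂ :=
  T (planeWave L (-n))

/-- The symbol `1 + |k|²` of `-Δ + 1`. -/
def symbol {d : ℕ} (L : ℝ) (n : Fin d → ℤ) : ℝ := 1 + ‖dualVec L n‖ ^ 2

/-- The norm `(∑ (1+|k|²)^t |T̂_k|²)^{1/2} ∈ [0,∞]` of the periodic Sobolev space of order `t`,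
which is also the `L²` norm of `(-Δ+1)^{t/2} T`. -/
def sobolevNorm {d : ℕ} {L : ℝ} (t : ℝ) (T : TestFn d L →ₗ[ℂ] ℂ) : ℝ≥0∞ :=
  (∑' n : Fin d → ℤ, ENNReal.ofReal (symbol L n ^ t * ‖coeff T n‖ ^ 2)) ^ (1 / 2 : ℝ)

/-- Membership in the periodic Sobolev space of real distributions of order `s ∈ ℝ`. -/
def MemSobolev {d : ℕ} {L : ℝ} (s : ℝ) (V : PeriodicDistribution d L) : Prop :=
  V.IsReal ∧ sobolevNorm s V.toLin < ∞

/-- The trigonometric polynomial `∑ c_k e_k`. -/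
def trigPoly {d : ℕ} (L : ℝ) (c : (Fin d → ℤ) →₀ ℂ) : TestFn d L :=
  c.sum fun n a => a • planeWave L n

/-- The `L²` norm `(∑ |c_k|²)^{1/2}` of the trigonometric polynomial `∑ c_k e_k`. -/
def trigNorm {d : ℕ} (c : (Fin d → ℤ) →₀ ℂ) : ℝ≥0∞ :=
  (c.sum fun _ a => ENNReal.ofReal (‖a‖ ^ 2)) ^ (1 / 2 : ℝ)

/-- The Fourier multiplier `(-Δ+1)^t` on trigonometric polynomials: `c_k ↦ (1+|k|²)^t c_k`. -/
def besselPow {d : ℕ} (L : ℝ) (t : ℝ) (c : (Fin d → ℤ) →₀ ℂ) : (Fin d → ℤ) →₀ ℂ :=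
  c.support.sum fun n => Finsupp.single n (((symbol L n ^ t : ℝ) : ℂ) * c n)

/-- The product `V ψ` of a distribution and a test function: `(V ψ)(φ) = V(ψ φ)`. -/
def mulTest {d : ℕ} {L : ℝ} (V : PeriodicDistribution d L) (ψ : TestFn d L) :
    TestFn d L →ₗ[ℂ] ℂ :=
  V.toLin ∘ₗ LinearMap.mulLeft ℂ ψ

/-- The norm `‖V‖_r = ‖(-Δ+1)^{-1/2+r/2} V (-Δ+1)^{-1/2+r/2}‖ ∈ [0,∞]` of the operator on the
periodic `L²` space. It is computed on trigonometric polynomials `ψ = ∑ c_k e_k`, which are dense in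
`L²`: the supremum over `ψ ≠ 0` of
`‖(-Δ+1)^{-1/2+r/2} (V ((-Δ+1)^{-1/2+r/2} ψ))‖_{L²} / ‖ψ‖_{L²}`, where the numerator is `∞` if
the distribution in it is not in `L²`. -/
def formNorm {d : ℕ} {L : ℝ} (r : ℝ) (V : PeriodicDistribution d L) : ℝ≥0∞ :=
  ⨆ (c : (Fin d → ℤ) →₀ ℂ) (_ : c ≠ 0),
    sobolevNorm (2 * (-1 / 2 + r / 2))
      (mulTest V (trigPoly L (besselPow L (-1 / 2 + r / 2) c))) / trigNorm c

/-- The regularity assumption on the potential for the exponent `r`: the potential `V` is real,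
periodic (which is part of its type), and `‖V‖_r < ∞`. -/
def SatisfiesAssumption {d : ℕ} {L : ℝ} (r : ℝ) (V : PeriodicDistribution d L) : Prop :=
  V.IsReal ∧ formNorm r V < ∞

end PeriodicPotential

end

/-! Write w = 1 + |k|², α = s/2, β = (1-r)/2. In the basis e_k the sandwiched potential is the
matrix L^{-d/2} w_k^{-β} V̂_{k-q} w_q^{-β}. Put V̂_p = w_p^{-α} u_p, so that the ℓ² norm of u is the
Sobolev norm of V. With p = k - q, the weight w_p^{-α} w_q^{-β} w_k^{-β} is at most a constant times
a_p + a_q + a_k, where a = w^{-(α+2β)} (`symbol_weight_le`). For s < 0 this needs α + β ≥ 0, which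
is r ≤ s + 1. The condition r < 1 + s/2 - d/4 says 2(α+2β) > d/2, which puts a in ℓ²
(`summable_symbol_rpow`). Each of the three kernels is bounded on ℓ²
(`ENNReal.tsum_weighted_conv_sq_le`): a u or a f lies in ℓ¹ by Cauchy–Schwarz and Young applies,
while for a_k the convolution u * f is bounded and multiplied by an ℓ² sequence. Working in `ℝ≥0∞`
avoids summability side conditions. -/

open scoped ENNReal NNReal

/-! ### Convolution inequalities in ℓ² -/

namespace ENNReal

/-- Cauchy–Schwarz for sums of extended nonnegative reals. -/
theorem tsum_mul_sq_le {ι : Type*} (f g : ι → ℝ≥0∞) :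
    (∑' i, f i * g i) ^ 2 ≤ (∑' i, f i ^ 2) * ∑' i, g i ^ 2 := by
  have key : ∑' i, f i * g i ≤ (∑' i, f i ^ 2) ^ (1 / 2 : ℝ) * (∑' i, g i ^ 2) ^ (1 / 2 : ℝ) := by
    rw [ENNReal.tsum_eq_iSup_sum]
    refine iSup_le fun t => (ENNReal.inner_le_Lp_mul_Lq t f g Real.HolderConjugate.two_two).trans ?_
    simp only [ENNReal.rpow_ofNat]
    gcongr <;> exact ENNReal.sum_le_tsum t
  calc (∑' i, f i * g i) ^ 2
      ≤ ((∑' i, f i ^ 2) ^ (1 / 2 : ℝ) * (∑' i, g i ^ 2) ^ (1 / 2 : ℝ)) ^ 2 := by gcongr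
    _ = _ := by
      rw [mul_pow, ← ENNReal.rpow_mul_natCast, ← ENNReal.rpow_mul_natCast]
      norm_num

/-- Young's inequality `ℓ¹ * ℓ² ⊆ ℓ²` on an abelian group. -/
theorem tsum_conv_sq_le {G : Type*} [AddCommGroup G] (f h : G → ℝ≥0∞) :
    ∑' k, (∑' q, f (k - q) * h q) ^ 2 ≤ (∑' q, h q) ^ 2 * ∑' p, f p ^ 2 := by
  have hcs (k : G) : (∑' q, f (k - q) * h q) ^ 2 ≤ (∑' q, f (k - q) ^ 2 * h q) * ∑' q, h q := by
    have hsq (x : ℝ≥0∞) : (x ^ (1 / 2 : ℝ)) ^ 2 = x := by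
      rw [← ENNReal.rpow_mul_natCast]; norm_num
    have hmul (x : ℝ≥0∞) : x ^ (1 / 2 : ℝ) * x ^ (1 / 2 : ℝ) = x := by
      rw [← sq, hsq]
    -- Splitting h = h^{1/2} h^{1/2} leaves one full power of h in each factor.
    have := tsum_mul_sq_le (fun q => f (k - q) * h q ^ (1 / 2 : ℝ)) fun q => h q ^ (1 / 2 : ℝ)
    simpa only [mul_pow, hsq, mul_assoc, hmul] using this
  calc ∑' k, (∑' q, f (k - q) * h q) ^ 2
      ≤ ∑' k, (∑' q, f (k - q) ^ 2 * h q) * ∑' q, h q := ENNReal.tsum_le_tsum hcs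
    _ = (∑' q, ∑' k, f (k - q) ^ 2 * h q) * ∑' q, h q := by
      rw [ENNReal.tsum_mul_right, ENNReal.tsum_comm]
    _ = (∑' q, h q) ^ 2 * ∑' p, f p ^ 2 := by
      have (q : G) : ∑' k, f (k - q) ^ 2 = ∑' p, f p ^ 2 :=
        (Equiv.subRight q).tsum_eq fun p => f p ^ 2
      simp only [ENNReal.tsum_mul_right, this, ENNReal.tsum_mul_left]
      ring

theorem tsum_conv_comm {G : Type*} [AddCommGroup G] (f h : G → ℝ≥0∞) (k : G) :
    ∑' q, f (k - q) * h q = ∑' q, h (k - q) * f q := by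
  rw [← (Equiv.subLeft k).tsum_eq]
  simp [mul_comm]

theorem add_add_sq_le (x y z : ℝ≥0∞) : (x + y + z) ^ 2 ≤ 3 * (x ^ 2 + y ^ 2 + z ^ 2) := by
  induction x with
  | top => simp
  | coe x =>
    induction y with
    | top => simp
    | coe y =>
      induction z with
      | top => simp
      | coe z =>
        norm_cast
        rw [← NNReal.coe_le_coe]
        push_cast
        nlinarith [sq_nonneg ((x : ℝ) - y), sq_nonneg ((y : ℝ) - z), sq_nonneg ((x : ℝ) - z)]

/-- The `ℓ²` bound for a convolution whose kernel carries the weight `a` in one of the three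
momenta. -/
theorem tsum_weighted_conv_sq_le {G : Type*} [AddCommGroup G] (a u f : G → ℝ≥0∞) :
    ∑' k, (∑' q, (a (k - q) + a q + a k) * (u (k - q) * f q)) ^ 2 ≤
      9 * (∑' p, a p ^ 2) * (∑' p, u p ^ 2) * ∑' q, f q ^ 2 := by
  set A := ∑' p, a p ^ 2
  set U := ∑' p, u p ^ 2
  set F := ∑' q, f q ^ 2
  have h₁ : ∑' k, (∑' q, (a (k - q) * u (k - q)) * f q) ^ 2 ≤ A * U * F := by
    -- Here a u is the ℓ¹ factor, so the roles in the convolution are exchanged before Young.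
    simp only [fun k => tsum_conv_comm (fun p => a p * u p) f k]
    refine (tsum_conv_sq_le f fun p => a p * u p).trans ?_
    gcongr
    exact tsum_mul_sq_le a u
  have h₂ : ∑' k, (∑' q, u (k - q) * (a q * f q)) ^ 2 ≤ A * U * F := by
    refine (tsum_conv_sq_le u fun p => a p * f p).trans ?_
    rw [mul_right_comm]
    gcongr
    exact tsum_mul_sq_le a f
  have h₃ : ∑' k, (∑' q, a k * (u (k - q) * f q)) ^ 2 ≤ A * U * F := by
    have (k : G) : (∑' q, a k * (u (k - q) * f q)) ^ 2 ≤ a k ^ 2 * (U * F) := by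
      rw [ENNReal.tsum_mul_left, mul_pow]
      gcongr
      refine (tsum_mul_sq_le (fun q => u (k - q)) f).trans_eq ?_
      congr 1
      exact (Equiv.subLeft k).tsum_eq fun p => u p ^ 2
    refine (ENNReal.tsum_le_tsum this).trans_eq ?_
    rw [ENNReal.tsum_mul_right, mul_assoc]
  -- The 9 is 3 from the square of a three-term sum, times 3 for the equal bounds.
  calc _ ≤ ∑' k, 3 * ((∑' q, (a (k - q) * u (k - q)) * f q) ^ 2 +
          (∑' q, u (k - q) * (a q * f q)) ^ 2 + (∑' q, a k * (u (k - q) * f q)) ^ 2) := by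
        refine ENNReal.tsum_le_tsum fun k => le_of_eq_of_le ?_ (add_add_sq_le _ _ _)
        rw [← ENNReal.tsum_add, ← ENNReal.tsum_add]
        congr! 3 with q
        ring
    _ ≤ 3 * (A * U * F + A * U * F + A * U * F) := by
        rw [ENNReal.tsum_mul_left, ENNReal.tsum_add, ENNReal.tsum_add]
        gcongr
    _ = 9 * A * U * F := by ring

end ENNReal

/-! ### Weights on the dual lattice -/

namespace PeriodicPotential

theorem one_le_symbol {d : ℕ} (L : ℝ) (n : Fin d → ℤ) : 1 ≤ symbol L n := by
  simp only [symbol]; nlinarith [sq_nonneg ‖dualVec L n‖]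

theorem dualVec_sub {d : ℕ} (L : ℝ) (k q : Fin d → ℤ) :
    dualVec L (k - q) = dualVec L k - dualVec L q := by
  ext i
  simp [dualVec, mul_sub]

theorem dualVec_add {d : ℕ} (L : ℝ) (k q : Fin d → ℤ) :
    dualVec L (k + q) = dualVec L k + dualVec L q := by
  ext i
  simp [dualVec, mul_add]

/-- Triangle inequality and (a+b)² ≤ 2(a²+b²). For s < 0 the weight in k - q grows, and this bound
lets the weights in k and q absorb it. -/
theorem symbol_sub_le {d : ℕ} (L : ℝ) (k q : Fin d → ℤ) :
    symbol L (k - q) ≤ 2 * (symbol L k + symbol L q) := by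
  simp only [symbol, dualVec_sub]
  have h := norm_sub_le (dualVec L k) (dualVec L q)
  nlinarith [sq_nonneg (‖dualVec L k‖ - ‖dualVec L q‖), norm_nonneg (dualVec L k - dualVec L q)]

/-- The weights are summable as soon as the exponent exceeds half the dimension. -/
theorem summable_symbol_rpow {d : ℕ} (hd : 1 ≤ d) {L : ℝ} (hL : 0 < L) {σ : ℝ}
    (hσ : (d : ℝ) / 2 < σ) : Summable fun n : Fin d → ℤ => symbol L n ^ (-σ) := by
  let b := (EuclideanSpace.basisFun (Fin d) ℝ).toBasis
  let Λ := Submodule.span ℤ (Set.range b)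
  have hrank : Module.finrank ℤ Λ = d := by
    rw [ZLattice.rank ℝ Λ, finrank_euclideanSpace_fin]
  let z (n : Fin d → ℤ) : Λ := ⟨∑ i, n i • b i,
    Submodule.sum_mem _ fun i _ => Submodule.smul_mem _ _ (Submodule.subset_span ⟨i, rfl⟩)⟩
  have hz (n : Fin d → ℤ) (i : Fin d) : (z n : EuclideanSpace ℝ (Fin d)) i = n i := by
    simp [z, b, Finset.sum_apply, Pi.single_apply]
  have hinj : Function.Injective z := fun m n h => by
    ext i
    have := congrArg (fun x : Λ => (x : EuclideanSpace ℝ (Fin d)) i) h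
    simpa [hz] using this
  have hdual (n : Fin d → ℤ) :
      dualVec L n = (2 * Real.pi / L) • (z n : EuclideanSpace ℝ (Fin d)) := by
    ext i
    simp [dualVec, hz]
  have hsum : Summable fun n => ‖z n‖ ^ (-(2 * σ)) :=
    (ZLattice.summable_norm_rpow Λ (-(2 * σ)) (by rw [hrank]; linarith)).comp_injective hinj
  have hc : 0 < 2 * Real.pi / L := by positivity
  have hσ0 : 0 ≤ σ := (by positivity : (0 : ℝ) ≤ d / 2).trans hσ.le
  refine Summable.of_norm_bounded_eventually
    (hsum.mul_left ((2 * Real.pi / L) ^ (-(2 * σ)))) ?_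
  -- The origin is excluded: there the comparison function is a negative power of 0, which evaluates
  -- to 0.
  refine (Set.finite_singleton (0 : Fin d → ℤ)).subset fun n hn => ?_
  by_contra hn0
  refine hn (Set.mem_ofPred_eq ▸ ?_)
  have hpos : 0 < ‖z n‖ := by
    refine norm_pos_iff.2 fun h => hn0 (hinj ?_)
    rw [h]
    ext i
    simp [hz]
  have hnorm : ‖dualVec L n‖ = 2 * Real.pi / L * ‖z n‖ := by
    rw [hdual, norm_smul, Real.norm_of_nonneg hc.le]; rfl
  rw [Real.norm_of_nonneg (Real.rpow_nonneg (zero_le_one.trans (one_le_symbol L n)) _),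
    ← Real.mul_rpow hc.le hpos.le, ← hnorm]
  have hpos' : 0 < ‖dualVec L n‖ := by rw [hnorm]; positivity
  calc symbol L n ^ (-σ) ≤ (‖dualVec L n‖ ^ 2) ^ (-σ) :=
        Real.rpow_le_rpow_of_nonpos (by positivity) (by simp [symbol]) (by linarith)
    _ = ‖dualVec L n‖ ^ (-(2 * σ)) := by
        rw [← Real.rpow_natCast_mul hpos'.le]; congr 1; push_cast; ring

/-- For nonnegative exponents the product of three weights is dominated by the sum of the three
weights carrying the total exponent. -/
theorem rpow_mul_rpow_mul_rpow_le {x y z α β : ℝ} (hx : 1 ≤ x) (hy : 1 ≤ y) (hz : 1 ≤ z)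
    (hα : 0 ≤ α) (hβ : 0 ≤ β) :
    x ^ (-α) * y ^ (-β) * z ^ (-β) ≤
      x ^ (-(α + 2 * β)) + y ^ (-(α + 2 * β)) + z ^ (-(α + 2 * β)) := by
  -- m will be the smallest of x, y, z; all exponents are nonpositive, so replacing each base by m
  -- only increases the product.
  have key (m : ℝ) (hm : 1 ≤ m) (hmx : m ≤ x) (hmy : m ≤ y) (hmz : m ≤ z) :
      x ^ (-α) * y ^ (-β) * z ^ (-β) ≤ m ^ (-(α + 2 * β)) := by
    have hm0 : 0 < m := by linarith
    calc x ^ (-α) * y ^ (-β) * z ^ (-β) ≤ m ^ (-α) * m ^ (-β) * m ^ (-β) := by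
          have h₁ := Real.rpow_le_rpow_of_nonpos hm0 hmx (neg_nonpos.2 hα)
          have h₂ := Real.rpow_le_rpow_of_nonpos hm0 hmy (neg_nonpos.2 hβ)
          have h₃ := Real.rpow_le_rpow_of_nonpos hm0 hmz (neg_nonpos.2 hβ)
          gcongr
      _ = m ^ (-(α + 2 * β)) := by
          rw [← Real.rpow_add hm0, ← Real.rpow_add hm0]; congr 1; ring
  have hX : 0 ≤ x ^ (-(α + 2 * β)) := by positivity
  have hY : 0 ≤ y ^ (-(α + 2 * β)) := by positivity
  have hZ : 0 ≤ z ^ (-(α + 2 * β)) := by positivity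
  rcases le_total x y with hxy | hxy <;> rcases le_total y z with hyz | hyz <;>
    rcases le_total x z with hxz | hxz
  all_goals first
    | linarith [key x hx le_rfl (by linarith) (by linarith)]
    | linarith [key y hy (by linarith) le_rfl (by linarith)]
    | linarith [key z hz (by linarith) (by linarith) le_rfl]

/-- The negative-order case: a growing weight in `x ≲ y + z` is absorbed by the other two. -/
theorem rpow_mul_rpow_mul_rpow_le_of_le_add {x y z α β : ℝ} (hx : 1 ≤ x) (hy : 1 ≤ y)
    (hz : 1 ≤ z) (hxyz : x ≤ 2 * (y + z)) (hα : α ≤ 0) (hαβ : 0 ≤ α + β) :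
    x ^ (-α) * y ^ (-β) * z ^ (-β) ≤
      4 ^ (-α) * (y ^ (-(α + 2 * β)) + z ^ (-(α + 2 * β))) := by
  -- With z the larger of the two, x ≤ 2(y+z) ≤ 4z. The remaining exponent -(α+β) of z is
  -- nonpositive, so z may be lowered to y.
  have key (y z : ℝ) (hy : 1 ≤ y) (hyz : y ≤ z) (hxz : x ≤ 4 * z) :
      x ^ (-α) * y ^ (-β) * z ^ (-β) ≤ 4 ^ (-α) * y ^ (-(α + 2 * β)) := by
    have hy0 : 0 < y := by linarith
    have hz0 : 0 < z := by linarith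
    calc x ^ (-α) * y ^ (-β) * z ^ (-β) ≤ (4 * z) ^ (-α) * y ^ (-β) * z ^ (-β) := by
          have := Real.rpow_le_rpow (by linarith) hxz (neg_nonneg.2 hα)
          gcongr
      _ = 4 ^ (-α) * (y ^ (-β) * z ^ (-(α + β))) := by
          rw [Real.mul_rpow (by norm_num) hz0.le, neg_add, Real.rpow_add hz0]; ring
      _ ≤ 4 ^ (-α) * (y ^ (-β) * y ^ (-(α + β))) := by
          have := Real.rpow_le_rpow_of_nonpos hy0 hyz (neg_nonpos.2 hαβ)
          gcongr
      _ = 4 ^ (-α) * y ^ (-(α + 2 * β)) := by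
          rw [← Real.rpow_add hy0]; congr 2; ring
  have h4 : (0 : ℝ) ≤ 4 ^ (-α) := by positivity
  have hY : 0 ≤ y ^ (-(α + 2 * β)) := by positivity
  have hZ : 0 ≤ z ^ (-(α + 2 * β)) := by positivity
  rw [mul_add]
  rcases le_total y z with h | h
  · have := key y z hy h (by linarith)
    nlinarith [mul_nonneg h4 hZ]
  · have := key z y hz h (by linarith)
    rw [mul_right_comm] at this
    nlinarith [mul_nonneg h4 hY]

/-- The weight of the matrix element of `V` between `e_k` and `e_q` in the form norm. -/
theorem symbol_weight_le {d : ℕ} (L : ℝ) {s r : ℝ} (hr1 : r ≤ 1) (hrs : r ≤ s + 1)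
    (k q : Fin d → ℤ) :
    symbol L k ^ ((r - 1) / 2) * symbol L q ^ ((r - 1) / 2) * symbol L (k - q) ^ (-(s / 2)) ≤
      4 ^ (|s| / 2) * (symbol L (k - q) ^ (-((s + 2 * (1 - r)) / 2)) +
        symbol L q ^ (-((s + 2 * (1 - r)) / 2)) + symbol L k ^ (-((s + 2 * (1 - r)) / 2))) := by
  have hk := one_le_symbol L k
  have hq := one_le_symbol L q
  have hp := one_le_symbol L (k - q)
  have hsum := symbol_sub_le L k q
  set x := symbol L (k - q)
  set y := symbol L q
  set z := symbol L k
  have e₁ : (r - 1) / 2 = -((1 - r) / 2) := by ring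
  have e₂ : (s + 2 * (1 - r)) / 2 = s / 2 + 2 * ((1 - r) / 2) := by ring
  rw [e₁, e₂, mul_comm, mul_comm (z ^ _), ← mul_assoc]
  -- The constant 4^{|s|/2} serves both signs of s: it is 4^{-α} for s ≤ 0 and at least 1 otherwise.
  have h4 : (1 : ℝ) ≤ 4 ^ (|s| / 2) := Real.one_le_rpow (by norm_num) (by positivity)
  have hX : 0 ≤ x ^ (-(s / 2 + 2 * ((1 - r) / 2))) := by positivity
  have hY : 0 ≤ y ^ (-(s / 2 + 2 * ((1 - r) / 2))) := by positivity
  have hZ : 0 ≤ z ^ (-(s / 2 + 2 * ((1 - r) / 2))) := by positivity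
  rcases le_total 0 s with hs | hs
  · refine (rpow_mul_rpow_mul_rpow_le hp hq hk (by linarith) (by linarith)).trans ?_
    exact le_mul_of_one_le_left (by positivity) h4
  · refine (rpow_mul_rpow_mul_rpow_le_of_le_add hp hq hk (by linarith) (by linarith)
      (by linarith)).trans ?_
    rw [abs_of_nonpos hs, neg_div]
    gcongr
    linarith

/-! ### Fourier coefficients of the sandwiched potential -/

theorem planeWave_mul {d : ℕ} (L : ℝ) (m n : Fin d → ℤ) :
    planeWave L m * planeWave L n =
      ((L ^ (-(d : ℝ) / 2) : ℝ) : ℂ) • planeWave L (m + n) := by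
  ext x
  rw [MulMemClass.coe_mul, Pi.mul_apply]
  simp only [planeWave, SetLike.val_smul, Pi.smul_apply,
    smul_eq_mul, dualVec_add, inner_add_left, Complex.ofReal_add, mul_add, Complex.exp_add]
  ring

theorem trigPoly_besselPow {d : ℕ} (L t : ℝ) (c : (Fin d → ℤ) →₀ ℂ) :
    trigPoly L (besselPow L t c) =
      ∑ n ∈ c.support, (((symbol L n ^ t : ℝ) : ℂ) * c n) • planeWave L n := by
  rw [trigPoly, besselPow, ← Finsupp.sum_finsetSum_index (h := fun n a => a • planeWave L n)
    (fun _ => zero_smul _ _) (fun _ _ _ => add_smul _ _ _)]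
  exact Finset.sum_congr rfl fun n _ => Finsupp.sum_single_index (zero_smul _ _)

/-- Multiplication by `V` acts on Fourier coefficients by convolution. -/
theorem coeff_mulTest_trigPoly_besselPow {d : ℕ} {L : ℝ} (V : PeriodicDistribution d L) (t : ℝ)
    (c : (Fin d → ℤ) →₀ ℂ) (k : Fin d → ℤ) :
    coeff (mulTest V (trigPoly L (besselPow L t c))) k =
      ∑ q ∈ c.support, ((symbol L q ^ t : ℝ) : ℂ) * c q *
        (((L ^ (-(d : ℝ) / 2) : ℝ) : ℂ) * coeff V.toLin (k - q)) := by
  simp only [coeff, mulTest, LinearMap.comp_apply, LinearMap.mulLeft_apply, trigPoly_besselPow,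
    Finset.sum_mul, map_sum, smul_mul_assoc, planeWave_mul, map_smul, smul_eq_mul, neg_sub,
    ← sub_eq_add_neg]

theorem trigNorm_eq {d : ℕ} (c : (Fin d → ℤ) →₀ ℂ) :
    trigNorm c = (∑' q, ENNReal.ofReal ‖c q‖ ^ 2) ^ (1 / 2 : ℝ) := by
  rw [trigNorm, Finsupp.sum, tsum_eq_sum (s := c.support)]
  · simp only [ENNReal.ofReal_pow (norm_nonneg _)]
  · intro q hq
    simp [Finsupp.notMem_support_iff.1 hq]

theorem sobolevNorm_eq {d : ℕ} {L : ℝ} (t : ℝ) (T : TestFn d L →ₗ[ℂ] ℂ) :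
    sobolevNorm t T =
      (∑' n, ENNReal.ofReal (symbol L n ^ (t / 2) * ‖coeff T n‖) ^ 2) ^ (1 / 2 : ℝ) := by
  rw [sobolevNorm]
  congr! 3 with n
  have h0 : 0 ≤ symbol L n := zero_le_one.trans (one_le_symbol L n)
  rw [← ENNReal.ofReal_pow (by positivity), mul_pow, ← Real.rpow_mul_natCast h0]
  congr 3
  push_cast
  ring

/-- The pointwise bound for the Fourier coefficients of the sandwiched potential. -/
theorem ofReal_symbol_mul_coeff_le {d : ℕ} {L : ℝ} (hL : 0 < L) {s r : ℝ} (hr1 : r ≤ 1)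
    (hrs : r ≤ s + 1) (V : PeriodicDistribution d L) (c : (Fin d → ℤ) →₀ ℂ) (k : Fin d → ℤ) :
    ENNReal.ofReal (symbol L k ^ ((r - 1) / 2) *
        ‖coeff (mulTest V (trigPoly L (besselPow L ((r - 1) / 2) c))) k‖) ≤
      ENNReal.ofReal (L ^ (-(d : ℝ) / 2) * 4 ^ (|s| / 2)) *
        ∑' q, (ENNReal.ofReal (symbol L (k - q) ^ (-((s + 2 * (1 - r)) / 2))) +
            ENNReal.ofReal (symbol L q ^ (-((s + 2 * (1 - r)) / 2))) +
            ENNReal.ofReal (symbol L k ^ (-((s + 2 * (1 - r)) / 2)))) *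
          (ENNReal.ofReal (symbol L (k - q) ^ (s / 2) * ‖coeff V.toLin (k - q)‖) *
            ENNReal.ofReal ‖c q‖) := by
  have h0 (n : Fin d → ℤ) : 0 < symbol L n := zero_lt_one.trans_le (one_le_symbol L n)
  have hpow (n : Fin d → ℤ) (t : ℝ) : 0 ≤ symbol L n ^ t := Real.rpow_nonneg (h0 n).le t
  have hLd : 0 ≤ L ^ (-(d : ℝ) / 2) := by positivity
  set τ := -((s + 2 * (1 - r)) / 2)
  have hterm (q : Fin d → ℤ) :
      symbol L k ^ ((r - 1) / 2) * ‖((symbol L q ^ ((r - 1) / 2) : ℝ) : ℂ) * c q *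
        (((L ^ (-(d : ℝ) / 2) : ℝ) : ℂ) * coeff V.toLin (k - q))‖ ≤
      L ^ (-(d : ℝ) / 2) * 4 ^ (|s| / 2) *
        ((symbol L (k - q) ^ τ + symbol L q ^ τ + symbol L k ^ τ) *
          (symbol L (k - q) ^ (s / 2) * ‖coeff V.toLin (k - q)‖ * ‖c q‖)) := by
    have hw := symbol_weight_le L hr1 hrs k q
    -- Inserting this product equal to 1 turns V̂ into the ℓ² sequence u of the Sobolev norm.
    have hinv : symbol L (k - q) ^ (-(s / 2)) * symbol L (k - q) ^ (s / 2) = 1 := by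
      rw [← Real.rpow_add (h0 _)]; simp
    simp only [norm_mul, Complex.norm_real, Real.norm_of_nonneg (hpow _ _),
      Real.norm_of_nonneg hLd]
    calc _ = L ^ (-(d : ℝ) / 2) *
          (symbol L k ^ ((r - 1) / 2) * symbol L q ^ ((r - 1) / 2) *
            (symbol L (k - q) ^ (-(s / 2)) * symbol L (k - q) ^ (s / 2))) *
            (‖coeff V.toLin (k - q)‖ * ‖c q‖) := by rw [hinv]; ring
      _ = L ^ (-(d : ℝ) / 2) *
          (symbol L k ^ ((r - 1) / 2) * symbol L q ^ ((r - 1) / 2) *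
            symbol L (k - q) ^ (-(s / 2))) *
            (symbol L (k - q) ^ (s / 2) * ‖coeff V.toLin (k - q)‖ * ‖c q‖) := by ring
      _ ≤ L ^ (-(d : ℝ) / 2) * (4 ^ (|s| / 2) *
            (symbol L (k - q) ^ τ + symbol L q ^ τ + symbol L k ^ τ)) *

            (symbol L (k - q) ^ (s / 2) * ‖coeff V.toLin (k - q)‖ * ‖c q‖) := by
          have := hpow (k - q) (s / 2)
          gcongr
      _ = _ := by ring
  rw [coeff_mulTest_trigPoly_besselPow]
  calc _ ≤ ENNReal.ofReal (∑ q ∈ c.support, L ^ (-(d : ℝ) / 2) * 4 ^ (|s| / 2) *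
        ((symbol L (k - q) ^ τ + symbol L q ^ τ + symbol L k ^ τ) *
          (symbol L (k - q) ^ (s / 2) * ‖coeff V.toLin (k - q)‖ * ‖c q‖))) := by
        refine ENNReal.ofReal_le_ofReal ?_
        refine (mul_le_mul_of_nonneg_left (norm_sum_le _ _) (hpow _ _)).trans ?_
        rw [Finset.mul_sum]
        exact Finset.sum_le_sum fun q _ => hterm q
    _ = ENNReal.ofReal (L ^ (-(d : ℝ) / 2) * 4 ^ (|s| / 2)) * ∑ q ∈ c.support, _ := by
        rw [← Finset.mul_sum, ENNReal.ofReal_mul (by positivity),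
          ENNReal.ofReal_sum_of_nonneg fun q _ => by
            have h₁ := hpow (k - q) τ
            have h₂ := hpow q τ
            have h₃ := hpow k τ
            have h₄ := hpow (k - q) (s / 2)
            positivity]
    _ ≤ _ := by
        gcongr
        refine le_of_eq_of_le (Finset.sum_congr rfl fun q _ => ?_) (ENNReal.sum_le_tsum c.support)
        rw [ENNReal.ofReal_mul (add_nonneg (add_nonneg (hpow _ _) (hpow _ _)) (hpow _ _)),
          ENNReal.ofReal_add (add_nonneg (hpow _ _) (hpow _ _)) (hpow _ _),
          ENNReal.ofReal_add (hpow _ _) (hpow _ _),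
          ENNReal.ofReal_mul (mul_nonneg (hpow _ _) (norm_nonneg _))]

/-- The form norm is bounded by the Sobolev norm, with an explicit constant. -/
theorem formNorm_le {d : ℕ} {L : ℝ} (hL : 0 < L) {s r : ℝ} (hr1 : r ≤ 1)
    (hrs : r ≤ s + 1) (V : PeriodicDistribution d L) :
    formNorm r V ≤ ENNReal.ofReal (L ^ (-(d : ℝ) / 2) * 4 ^ (|s| / 2)) *
      (9 * ∑' n : Fin d → ℤ,
        ENNReal.ofReal (symbol L n ^ (-(s + 2 * (1 - r))))) ^ (1 / 2 : ℝ) *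
      sobolevNorm s V.toLin := by
  have hA : ∑' n : Fin d → ℤ, ENNReal.ofReal (symbol L n ^ (-(s + 2 * (1 - r)))) =
      ∑' n : Fin d → ℤ, ENNReal.ofReal (symbol L n ^ (-((s + 2 * (1 - r)) / 2))) ^ 2 := by
    congr! 2 with n
    have h0 : 0 ≤ symbol L n := zero_le_one.trans (one_le_symbol L n)
    rw [← ENNReal.ofReal_pow (by positivity), ← Real.rpow_mul_natCast h0]
    congr 2
    push_cast
    ring
  refine iSup₂_le fun c _ => ENNReal.div_le_of_le_mul ?_
  have e₁ : 2 * (-1 / 2 + r / 2) / 2 = (r - 1) / 2 := by ring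
  have e₂ : -1 / 2 + r / 2 = (r - 1) / 2 := by ring
  rw [sobolevNorm_eq, sobolevNorm_eq, trigNorm_eq, hA, e₁, e₂]
  set K := ENNReal.ofReal (L ^ (-(d : ℝ) / 2) * 4 ^ (|s| / 2))
  -- K is moved under the square root, so that the claim becomes an inequality between squared ℓ²
  -- norms.
  have hK : K = (K ^ 2) ^ (1 / 2 : ℝ) := by
    rw [← ENNReal.rpow_natCast_mul]; norm_num
  rw [hK, ← ENNReal.mul_rpow_of_nonneg _ _ (by norm_num),
    ← ENNReal.mul_rpow_of_nonneg _ _ (by norm_num),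
    ← ENNReal.mul_rpow_of_nonneg _ _ (by norm_num)]
  refine ENNReal.rpow_le_rpow ?_ (by norm_num)
  calc _ ≤ _ := ENNReal.tsum_le_tsum fun k =>
        pow_le_pow_left' (ofReal_symbol_mul_coeff_le hL hr1 hrs V c k) 2
    _ ≤ _ := by
        simp only [mul_pow]
        rw [ENNReal.tsum_mul_left, mul_assoc, mul_assoc (K ^ 2)]
        gcongr
        rw [← mul_assoc]
        exact ENNReal.tsum_weighted_conv_sq_le
          (fun n => ENNReal.ofReal (symbol L n ^ (-((s + 2 * (1 - r)) / 2))))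
          (fun n => ENNReal.ofReal (symbol L n ^ (s / 2) * ‖coeff V.toLin n‖))
          fun n => ENNReal.ofReal ‖c n‖

end PeriodicPotential

/-! ### Finiteness of the constant -/

theorem lemmaA2 (d : ℕ) (hd : 1 ≤ d) (L : ℝ) (hL : 0 < L) (s r : ℝ)
    (hr0 : 0 ≤ r) (hr1 : r ≤ 1) (hrs : r ≤ s + 1) (hrd : r < 1 + s / 2 - (d : ℝ) / 4) :
    ∃ C : ℝ≥0, ∀ V : PeriodicPotential.PeriodicDistribution d L,
      PeriodicPotential.MemSobolev s V →
        PeriodicPotential.SatisfiesAssumption r V ∧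
          PeriodicPotential.formNorm r V ≤
            (C : ℝ≥0∞) * PeriodicPotential.sobolevNorm s V.toLin := by
  -- The exponent is that of a², and the inequality is `hrd` multiplied by 2 and rearranged.
  have hsum := PeriodicPotential.summable_symbol_rpow hd hL
    (show (d : ℝ) / 2 < s + 2 * (1 - r) by linarith)
  set K : ℝ≥0∞ := ENNReal.ofReal (L ^ (-(d : ℝ) / 2) * 4 ^ (|s| / 2)) *
    (9 * ∑' n : Fin d → ℤ, ENNReal.ofReal
      (PeriodicPotential.symbol L n ^ (-(s + 2 * (1 - r))))) ^ (1 / 2 : ℝ) with hKdef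
  have hK : K ≠ ∞ := by
    refine ENNReal.mul_ne_top ENNReal.ofReal_ne_top (ENNReal.rpow_ne_top_of_nonneg (by norm_num) ?_)
    exact ENNReal.mul_ne_top (by norm_num) hsum.tsum_ofReal_ne_top
  refine ⟨K.toNNReal, fun V hV => ?_⟩
  rw [ENNReal.coe_toNNReal hK]
  have hle : PeriodicPotential.formNorm r V ≤ K * PeriodicPotential.sobolevNorm s V.toLin :=
    PeriodicPotential.formNorm_le hL hr1 hrs V
  exact ⟨⟨hV.1, hle.trans_lt (ENNReal.mul_lt_top hK.lt_top hV.2)⟩, hle⟩
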